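/- **Theorem 3.1.** For a finite graph $G$ and a perfect matching $M$ of $G$, a forcing set of $M$ is a set $S\subseteq M$ of edges that is contained in no perfect matching of $G$ other than $M$; the forcing number $f(G,M)$ is the smallest size of a forcing set of $M$; and the forcing polynomial of $G$ is $F(G,x)=\sum_{M} x^{f(G,M)}$, the sum being over all perfect matchings $M$ of $G$. Let $G_0$ be the null graph (the graph without vertices). For $n\ge 1$ let $G_n$ be the polyomino graph consisting of $4n$ squares with vertices $u_i,v_i$ ($0\le i\le 2n$) and $w_i,z_i$ ($1\le i\le 2n$) and with edges $u_iv_i$ ($0\le i\le 2n$); $w_iu_i$ and $v_iz_i$ ($1\le i\le 2n$); $u_{i-1}u_i$ and $v_{i-1}v_i$ ($1\le i\le 2n$); $w_{2k-1}w_{2k}$ and $z_{2k-1}z_{2k}$ ($1\le k\le n$). Then for every $n\ge 3$ $$F(G_n,x)=(4x^2+3x)\,F(G_{n-1},x)-(8x^3+2x^2)\,F(G_{n-2},x)+4x^3\,F(G_{n-3},x),$$ where $F(G_0,x)=1$, $F(G_1,x)=4x^2+2x$ and $F(G_2,x)=16x^4+12x^3+4x^2$. -/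

import Mathlib

open Polynomial

namespace ForcingPoly

section General

variable {V : Type*} {G : SimpleGraph V}

/-- A set `S` of edges is a forcing set of the perfect matching `M` of `G` if `S ⊆ M` and no other
perfect matching of `G` contains `S`. -/
def IsForcingSet (M : G.Subgraph) (S : Set (Sym2 V)) : Prop :=
  S ⊆ M.edgeSet ∧
    ∀ M' : G.Subgraph, M'.IsPerfectMatching → S ⊆ M'.edgeSet → M' = M

/-- The forcing number `f(G, M)`: the smallest size of a forcing set of `M`. -/
noncomputable def forcingNumber (M : G.Subgraph) : ℕ :=
  sInf {k : ℕ | ∃ S : Finset (Sym2 V), IsForcingSet M (S : Set (Sym2 V)) ∧ S.card = k}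

/-- In a finite graph the minimum defining the forcing number of a perfect matching is attained. -/
theorem exists_forcingSet_card_eq [Finite V] (M : G.Subgraph) (hM : M.IsPerfectMatching) :
    ∃ S : Finset (Sym2 V), IsForcingSet M (S : Set (Sym2 V)) ∧ S.card = forcingNumber M := by
  apply Nat.sInf_mem
    (s := {k : ℕ | ∃ S : Finset (Sym2 V), IsForcingSet M (S : Set (Sym2 V)) ∧ S.card = k})
  refine ⟨_, (Set.toFinite M.edgeSet).toFinset, ⟨by simp, ?_⟩, rfl⟩
  intro M' hM' hS
  rw [Set.Finite.coe_toFinset] at hS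
  have key : ∀ a b, M.Adj a b → M'.Adj a b := fun a b h => by
    have := @hS s(a, b) (by simpa using h)
    simpa using this
  refine SimpleGraph.Subgraph.ext ?_ ?_
  · rw [hM.2.verts_eq_univ, hM'.2.verts_eq_univ]
  · funext a b
    refine propext ⟨fun h => ?_, key a b⟩
    obtain ⟨c, hc, -⟩ := SimpleGraph.Subgraph.isPerfectMatching_iff.1 hM a
    have := (SimpleGraph.Subgraph.isPerfectMatching_iff.1 hM' a).unique h (key a c hc)
    rw [this]
    exact hc

/-- The forcing polynomial `F(G, x) = ∑ x ^ f(G, M)`, the sum running over all perfect matchings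
`M` of the finite graph `G`. -/
noncomputable def forcingPolynomial [Finite V] (G : SimpleGraph V) : ℤ[X] :=
  ∑ M ∈ (Set.toFinite {M : G.Subgraph | M.IsPerfectMatching}).toFinset, X ^ forcingNumber M

end General

/-- The four rows of vertices, from top to bottom. -/
inductive Row
  | w | u | v | z
  deriving DecidableEq

instance : Fintype Row where
  elems := {Row.w, Row.u, Row.v, Row.z}
  complete := by intro r; cases r <;> decide

/-- The edges of the polyominoes, each listed in one direction; `(Row.u, i)` stands for `u_i`,
and so on. -/
inductive Edge : Row × ℕ → Row × ℕ → Prop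
  | wu (i : ℕ) : Edge (Row.w, i) (Row.u, i)
  | uv (i : ℕ) : Edge (Row.u, i) (Row.v, i)
  | vz (i : ℕ) : Edge (Row.v, i) (Row.z, i)
  | uu (i : ℕ) : Edge (Row.u, i) (Row.u, i + 1)
  | vv (i : ℕ) : Edge (Row.v, i) (Row.v, i + 1)
  | ww (i : ℕ) : Odd i → Edge (Row.w, i) (Row.w, i + 1)
  | zz (i : ℕ) : Odd i → Edge (Row.z, i) (Row.z, i + 1)

/-- The vertices of `G_n`: `u_i`, `v_i` for `0 ≤ i ≤ 2n` and `w_i`, `z_i` for `1 ≤ i ≤ 2n`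
if `n ≥ 1`, and none at all if `n = 0`. -/
def verts (n : ℕ) : Set (Row × ℕ) :=
  {p | 1 ≤ n ∧ p.2 ≤ 2 * n ∧ (p.1 = Row.w ∨ p.1 = Row.z → 1 ≤ p.2)}

instance verts_finite (n : ℕ) : Finite (verts n) := by
  refine Set.Finite.to_subtype
    (Set.Finite.subset (Set.Finite.prod Set.finite_univ (Set.finite_Iic (2 * n))) ?_)
  exact fun p hp => ⟨Set.mem_univ _, hp.2.1⟩

/-- The polyomino graph `G_n` with `4n` squares (the null graph if `n = 0`): a straight chain of
`2n` squares `u_{i-1} u_i v_i v_{i-1}`, together with, for each `1 ≤ k ≤ n`, a square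
`w_{2k-1} w_{2k} u_{2k} u_{2k-1}` above and a square `v_{2k-1} v_{2k} z_{2k} z_{2k-1}` below the
square `u_{2k-1} u_{2k} v_{2k} v_{2k-1}` of the chain. -/
def polyomino (n : ℕ) : SimpleGraph (verts n) where
  Adj p q := Edge p q ∨ Edge q p
  symm := ⟨fun _ _ h => h.symm⟩
  loopless := ⟨by
    rintro ⟨⟨r, i⟩, hp⟩ h
    have key : ∀ a b : Row × ℕ, Edge a b → a ≠ b := by
      intro a b hab
      cases hab <;> simp
    rcases h with h | h <;> exact key _ _ h rfl⟩

end ForcingPoly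

namespace ForcingPoly

/-! ### Bounds for forcing numbers in an arbitrary graph. -/

section Generic

variable {V : Type*} {G : SimpleGraph V}

/-! A perfect matching meets each pair of columns `2k+1`, `2k+2` in one of six ways, so it is coded
by a word of `n` letters; the only restriction is that `split` is never followed by `link true`
(`mate_spec`, `joined_block`, `wordMatching_readLetter`).

The forcing number is read off the word. A `split` costs 2, for its two alternating squares. A
maximal run of `m` consecutive `link`s costs `m`, except that it costs `m - 1` if a `split` precedes
it and it contains `link true`: then the first `link` comes for free. The lower bound uses pairwise
disjoint alternating squares, each flipped by changing one letter (`inSquare_unique`,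
`exists_flip`); the upper bound picks one edge per square and recovers the word from these edges
(`IsRun.eq_of_mate_eq`). Both counts are the cost of a run of an automaton
(`forcingNumber_wordMatching`).

Whether the free `link` occurs depends on later letters. The deterministic `weight` always charges
for the first `link` and refunds the charge at the first `link true`. Summing over words gives a
linear system for the sums with initial phases `cut`, `start`, `free`, with matrix `[[2x, 4x², 0],
[0, 4x², x], [1, 4x², x]]`. Its trace `4x² + 3x`, sum of principal minors `8x³ + 2x²` and
determinant `4x³` are the coefficients of the recurrence, by Cayley–Hamilton. -/

theorem eq_of_isPerfectMatching {M M' : G.Subgraph} (hM : M.IsPerfectMatching)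
    (hM' : M'.IsPerfectMatching) (h : ∀ p, ∃ q, M.Adj p q ∧ M'.Adj p q) : M = M' := by
  have key : ∀ p q, M.Adj p q ↔ M'.Adj p q := by
    intro p q
    obtain ⟨r, h1, h2⟩ := h p
    constructor
    · intro h3
      rwa [(SimpleGraph.Subgraph.isPerfectMatching_iff.1 hM p).unique h3 h1]
    · intro h3
      rwa [(SimpleGraph.Subgraph.isPerfectMatching_iff.1 hM' p).unique h3 h2]
  refine SimpleGraph.Subgraph.ext ?_ ?_
  · rw [hM.2.verts_eq_univ, hM'.2.verts_eq_univ]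
  · funext p q
    exact propext (key p q)

/-- The edges of `M` at the vertices of `P` form a forcing set if they determine `M`. -/
theorem forcingNumber_le_card {M : G.Subgraph} (hM : M.IsPerfectMatching) (P : Finset V)
    (hP : ∀ M' : G.Subgraph, M'.IsPerfectMatching →
      (∀ p ∈ P, ∀ q, M.Adj p q → M'.Adj p q) → M' = M) :
    forcingNumber M ≤ P.card := by
  classical
  choose m hm _ using SimpleGraph.Subgraph.isPerfectMatching_iff.1 hM
  refine le_trans (Nat.sInf_le ⟨P.image fun p => s(p, m p), ⟨?_, ?_⟩, rfl⟩) Finset.card_image_le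
  · intro e he
    simp only [Finset.coe_image, Set.mem_image] at he
    obtain ⟨p, -, rfl⟩ := he
    simpa using hm p
  · intro M' hM' hS
    refine hP M' hM' fun p hp q hpq => ?_
    have h1 : s(p, m p) ∈ M'.edgeSet := hS (by simpa using ⟨p, hp, Or.inl ⟨rfl, rfl⟩⟩)
    rw [(SimpleGraph.Subgraph.isPerfectMatching_iff.1 hM p).unique hpq (hm p)]
    simpa using h1

/-- Perfect matchings differing from `M` only on pairwise disjoint sets of vertices bound the
forcing number of `M` from below. -/
theorem card_le_forcingNumber [Finite V] {M : G.Subgraph} (hM : M.IsPerfectMatching)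
    {τ : Type*} (T : Finset τ) (own : V → τ → Prop)
    (huniq : ∀ p, ∀ t ∈ T, ∀ t' ∈ T, own p t → own p t' → t = t')
    (hflip : ∀ t ∈ T, ∃ M' : G.Subgraph, M'.IsPerfectMatching ∧ M' ≠ M ∧
      ∀ p, ¬ own p t → ∀ q, M.Adj p q → M'.Adj p q) :
    T.card ≤ forcingNumber M := by
  classical
  obtain ⟨S, ⟨hSM, hS⟩, hcard⟩ := exists_forcingSet_card_eq M hM
  rw [← hcard]
  have key : ∀ t ∈ T, ∃ e ∈ S, ∀ p ∈ e, own p t := by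
    intro t ht
    obtain ⟨M', hM', hne, hagree⟩ := hflip t ht
    -- If every edge of `S` had an end outside the region of `t`, then `M'` would contain `S`,
    -- although `S` forces `M`.
    by_contra! hcon
    refine hne (hS M' hM' fun e he => ?_)
    obtain ⟨p, hpe, hp⟩ := hcon e he
    obtain ⟨q, rfl⟩ := Sym2.mem_iff_exists.1 hpe
    have h1 : s(p, q) ∈ M.edgeSet := hSM he
    simpa using hagree p hp q (by simpa using h1)
  rcases T.eq_empty_or_nonempty with rfl | ⟨t₀, ht₀⟩
  · simp
  have : Nonempty (Sym2 V) := ⟨(key t₀ ht₀).choose⟩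
  choose! e heS he using key
  refine Finset.card_le_card_of_injOn e (fun t ht => heS t ht) fun t ht t' ht' hee => ?_
  obtain ⟨p, hp⟩ : ∃ p, p ∈ e t := ⟨_, Sym2.out_fst_mem (e t)⟩
  exact huniq p t ht t' ht' (he t ht p hp) (he t' ht' p (hee ▸ hp))

end Generic

/-! ### Coding perfect matchings by words. -/

/-- The possible restrictions of a perfect matching to the pair of columns `2 * k + 1` and
`2 * k + 2`: either the square above and the square below are matched separately (the Boolean says
whether vertically), or their outer edges are used and the Boolean says whether `u_{2k}u_{2k+1}`
and `v_{2k}v_{2k+1}` are used as well. -/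
inductive Letter
  | split (t b : Bool)
  | link (c : Bool)
  deriving DecidableEq, Fintype

open Letter

namespace Letter

/-- Whether the square above is matched vertically. -/
def top : Letter → Bool
  | split t _ => t
  | link _ => false

/-- Whether the square below is matched vertically. -/
def bot : Letter → Bool
  | split _ b => b
  | link _ => false

end Letter

/-- The partner of a vertex in the perfect matching described by a word. -/
def mate (a : ℕ → Letter) : Row × ℕ → Row × ℕ
  | (.w, i) =>
    if i % 2 = 1 then (if (a (i / 2)).top then (.u, i) else (.w, i + 1))
    else (if (a (i / 2 - 1)).top then (.u, i) else (.w, i - 1))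
  | (.z, i) =>
    if i % 2 = 1 then (if (a (i / 2)).bot then (.v, i) else (.z, i + 1))
    else (if (a (i / 2 - 1)).bot then (.v, i) else (.z, i - 1))
  | (.u, i) =>
    if i % 2 = 1 then
      match a (i / 2) with
      | split t _ => if t then (.w, i) else (.u, i + 1)
      | link c => if c then (.u, i - 1) else (.v, i)
    else if a (i / 2) = link true then (.u, i + 1)
    else if i = 0 then (.v, i)
    else
      match a (i / 2 - 1) with
      | split t _ => if t then (.w, i) else (.u, i - 1)
      | link _ => (.v, i)
  | (.v, i) =>
    if i % 2 = 1 then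
      match a (i / 2) with
      | split _ b => if b then (.z, i) else (.v, i + 1)
      | link c => if c then (.v, i - 1) else (.u, i)
    else if a (i / 2) = link true then (.v, i + 1)
    else if i = 0 then (.u, i)
    else
      match a (i / 2 - 1) with
      | split _ b => if b then (.z, i) else (.v, i - 1)
      | link _ => (.u, i)

section Mate

variable (a : ℕ → Letter) (k : ℕ)

theorem two_mul_add_one_div : (2 * k + 1) / 2 = k := by omega

theorem two_mul_add_one_mod : (2 * k + 1) % 2 = 1 := by omega

theorem two_mul_add_two_div : (2 * k + 2) / 2 = k + 1 := by omega

theorem two_mul_add_two_mod : (2 * k + 2) % 2 = 0 := by omega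

theorem mate_w_odd : mate a (.w, 2 * k + 1) =
    if (a k).top then (.u, 2 * k + 1) else (.w, 2 * k + 2) := by
  simp only [mate, two_mul_add_one_mod, two_mul_add_one_div, if_true]

theorem mate_w_even : mate a (.w, 2 * k + 2) =
    if (a k).top then (.u, 2 * k + 2) else (.w, 2 * k + 1) := by
  simp [mate, two_mul_add_two_mod, two_mul_add_two_div]

theorem mate_z_odd : mate a (.z, 2 * k + 1) =
    if (a k).bot then (.v, 2 * k + 1) else (.z, 2 * k + 2) := by
  simp only [mate, two_mul_add_one_mod, two_mul_add_one_div, if_true]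

theorem mate_z_even : mate a (.z, 2 * k + 2) =
    if (a k).bot then (.v, 2 * k + 2) else (.z, 2 * k + 1) := by
  simp [mate, two_mul_add_two_mod, two_mul_add_two_div]

theorem mate_u_odd : mate a (.u, 2 * k + 1) =
    match a k with
    | split t _ => if t then (.w, 2 * k + 1) else (.u, 2 * k + 2)
    | link c => if c then (.u, 2 * k) else (.v, 2 * k + 1) := by
  simp only [mate, two_mul_add_one_mod, two_mul_add_one_div, if_true]
  rfl

theorem mate_v_odd : mate a (.v, 2 * k + 1) =
    match a k with
    | split _ b => if b then (.z, 2 * k + 1) else (.v, 2 * k + 2)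
    | link c => if c then (.v, 2 * k) else (.u, 2 * k + 1) := by
  simp only [mate, two_mul_add_one_mod, two_mul_add_one_div, if_true]
  rfl

theorem mate_u_even : mate a (.u, 2 * k + 2) =
    if a (k + 1) = link true then (.u, 2 * k + 3) else
    match a k with
    | split t _ => if t then (.w, 2 * k + 2) else (.u, 2 * k + 1)
    | link _ => (.v, 2 * k + 2) := by
  simp [mate, two_mul_add_two_mod, two_mul_add_two_div]

theorem mate_v_even : mate a (.v, 2 * k + 2) =
    if a (k + 1) = link true then (.v, 2 * k + 3) else
    match a k with
    | split _ b => if b then (.z, 2 * k + 2) else (.v, 2 * k + 1)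
    | link _ => (.u, 2 * k + 2) := by
  simp [mate, two_mul_add_two_mod, two_mul_add_two_div]

theorem mate_u_zero : mate a (.u, 0) = if a 0 = link true then (.u, 1) else (.v, 0) := by
  simp [mate]

theorem mate_v_zero : mate a (.v, 0) = if a 0 = link true then (.v, 1) else (.u, 0) := by
  simp [mate]

end Mate

theorem mate_u_cut {a : ℕ → Letter} {k : ℕ} (h : a k = link true) :
    mate a (.u, 2 * k) = (.u, 2 * k + 1) := by
  cases k with
  | zero => simp [mate_u_zero, h]
  | succ k => simp [show 2 * (k + 1) = 2 * k + 2 by ring, mate_u_even, h]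

theorem mate_v_cut {a : ℕ → Letter} {k : ℕ} (h : a k = link true) :
    mate a (.v, 2 * k) = (.v, 2 * k + 1) := by
  cases k with
  | zero => simp [mate_v_zero, h]
  | succ k => simp [show 2 * (k + 1) = 2 * k + 2 by ring, mate_v_even, h]

/-- A word describes a perfect matching if `split` is never followed by `link true`. -/
def Valid (a : ℕ → Letter) : Prop :=
  ∀ k t b, a k = split t b → a (k + 1) ≠ link true

theorem column_cases (i : ℕ) : i = 0 ∨ (∃ k, i = 2 * k + 1) ∨ ∃ k, i = 2 * k + 2 := by
  rcases Nat.even_or_odd' i with ⟨k, rfl | rfl⟩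
  · cases k with
    | zero => exact Or.inl rfl
    | succ k => exact Or.inr (Or.inr ⟨k, by ring⟩)
  · exact Or.inr (Or.inl ⟨k, rfl⟩)

/-- A `link true` at `k + 1` claims `u_{2k+2}` and `v_{2k+2}`. If letter `k` is a `link`, these two
would only have been matched to each other, so nothing is stranded; after a `split` their former
partners would be, which is what `Valid` excludes. The hypothesis `hn` keeps the last column from
being matched to a missing one. -/
theorem mate_spec {a : ℕ → Letter} (ha : Valid a) {n : ℕ} (hn : ∀ k, n ≤ k → a k ≠ link true)
    {p : Row × ℕ} (hp : p ∈ verts n) :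
    mate a p ∈ verts n ∧ mate a (mate a p) = p ∧ (Edge p (mate a p) ∨ Edge (mate a p) p) := by
  obtain ⟨r, i⟩ := p
  obtain ⟨h1, h2, h3⟩ := hp
  rcases column_cases i with rfl | ⟨k, rfl⟩ | ⟨k, rfl⟩
  · have m0 : (Row.u, 0) ∈ verts n := ⟨h1, by simp, by simp⟩
    have m0' : (Row.v, 0) ∈ verts n := ⟨h1, by simp, by simp⟩
    have m1 : ∀ r, (r, 1) ∈ verts n := fun r => ⟨h1, by simp; omega, by simp⟩
    have e1 : Edge (.u, 0) (.u, 1) := .uu 0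
    have e2 : Edge (.v, 0) (.v, 1) := .vv 0
    have u1 := mate_u_odd a 0
    have v1 := mate_v_odd a 0
    simp only [Nat.mul_zero, Nat.zero_add] at u1 v1
    by_cases h : a 0 = link true <;> cases r <;> simp [mate_u_zero, mate_v_zero, Edge.uv, *] at h3 ⊢
  · have hk : k < n := by simp at h2; omega
    have m0 : (Row.u, 2 * k) ∈ verts n := ⟨h1, by simp; omega, by simp⟩
    have m0' : (Row.v, 2 * k) ∈ verts n := ⟨h1, by simp; omega, by simp⟩
    have m1 : ∀ r, (r, 2 * k + 1) ∈ verts n := fun r => ⟨h1, by simp; omega, by simp⟩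
    have m2 : ∀ r, (r, 2 * k + 2) ∈ verts n := fun r => ⟨h1, by simp; omega, by simp⟩
    have e1 : Edge (.w, 2 * k + 1) (.w, 2 * k + 2) := .ww _ (odd_two_mul_add_one k)
    have e2 : Edge (.z, 2 * k + 1) (.z, 2 * k + 2) := .zz _ (odd_two_mul_add_one k)
    have e3 : Edge (.u, 2 * k + 1) (.u, 2 * k + 2) := .uu _
    have e4 : Edge (.v, 2 * k + 1) (.v, 2 * k + 2) := .vv _
    have e5 : Edge (.u, 2 * k) (.u, 2 * k + 1) := .uu _
    have e6 : Edge (.v, 2 * k) (.v, 2 * k + 1) := .vv _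
    have hv := ha k
    rcases hak : a k with ⟨_ | _, _ | _⟩ | ⟨_ | _⟩ <;> cases r <;>
      simp [mate_w_odd, mate_w_even, mate_z_odd, mate_z_even, mate_u_odd, mate_u_even, mate_v_odd,
        mate_v_even, mate_u_cut, mate_v_cut, Letter.top, Letter.bot, Edge.wu, Edge.uv, Edge.vz,
        *] at hv ⊢ <;> exact hv
  · have hk : k < n := by simp at h2; omega
    have m1 : ∀ r, (r, 2 * k + 1) ∈ verts n := fun r => ⟨h1, by simp; omega, by simp⟩
    have m2 : ∀ r, (r, 2 * k + 2) ∈ verts n := fun r => ⟨h1, by simp; omega, by simp⟩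
    have m3 : a (k + 1) = link true → ∀ r, (r, 2 * k + 3) ∈ verts n := fun h r =>
      ⟨h1, by have := mt (hn (k + 1)) (not_not.2 h); simp; omega, by simp⟩
    have e1 : Edge (.w, 2 * k + 1) (.w, 2 * k + 2) := .ww _ (odd_two_mul_add_one k)
    have e2 : Edge (.z, 2 * k + 1) (.z, 2 * k + 2) := .zz _ (odd_two_mul_add_one k)
    have e3 : Edge (.u, 2 * k + 1) (.u, 2 * k + 2) := .uu _
    have e4 : Edge (.v, 2 * k + 1) (.v, 2 * k + 2) := .vv _
    have e5 : Edge (.u, 2 * k + 2) (.u, 2 * k + 3) := .uu _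
    have e6 : Edge (.v, 2 * k + 2) (.v, 2 * k + 3) := .vv _
    have hv := ha k
    have u3 := mate_u_odd a (k + 1)
    have v3 := mate_v_odd a (k + 1)
    rw [show 2 * (k + 1) + 1 = 2 * k + 3 by ring, show 2 * (k + 1) = 2 * k + 2 by ring] at u3 v3
    rcases hak : a k with ⟨_ | _, _ | _⟩ | ⟨_ | _⟩ <;> by_cases h : a (k + 1) = link true <;>
      cases r <;>
      simp [mate_w_odd, mate_w_even, mate_z_odd, mate_z_even, mate_u_odd, mate_u_even, mate_v_odd,
        mate_v_even, Letter.top, Letter.bot, Edge.wu, Edge.uv, Edge.vz, *] at hv ⊢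

/-- The perfect matching of the polyomino described by a word. -/
def wordMatching (a : ℕ → Letter) (n : ℕ) : (polyomino n).Subgraph where
  verts := Set.univ
  Adj p q := (polyomino n).Adj p q ∧ mate a p = q ∧ mate a q = p
  adj_sub h := h.1
  edge_vert _ := trivial
  symm := ⟨fun _ _ h => ⟨h.1.symm, h.2.2, h.2.1⟩⟩

theorem wordMatching_adj {a : ℕ → Letter} (ha : Valid a) {n : ℕ}
    (hn : ∀ k, n ≤ k → a k ≠ link true) {p q : verts n} :
    (wordMatching a n).Adj p q ↔ mate a p = q := by
  refine ⟨fun h => h.2.1, fun h => ?_⟩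
  obtain ⟨-, h2, h3⟩ := mate_spec ha hn p.2
  rw [h] at h2 h3
  exact ⟨h3, h, h2⟩

theorem wordMatching_isPerfectMatching {a : ℕ → Letter} (ha : Valid a) {n : ℕ}
    (hn : ∀ k, n ≤ k → a k ≠ link true) : (wordMatching a n).IsPerfectMatching := by
  refine SimpleGraph.Subgraph.isPerfectMatching_iff.2 fun p => ?_
  refine ⟨⟨mate a p, (mate_spec ha hn p.2).1⟩, (wordMatching_adj ha hn).2 rfl, fun q hq => ?_⟩
  exact Subtype.ext ((wordMatching_adj ha hn).1 hq).symm

/-! ### Every perfect matching comes from a word. -/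

/-- In a pair of columns, a perfect matching uses both or none of the edges leading to the right,
provided that it uses both or none of those coming from the left. -/
theorem block_cases {ww zz uu vv wl wr zl zr ml mr c d cu cv : Prop}
    (hwl : ww ∨ wl) (hwl' : ¬ (ww ∧ wl)) (hwr : ww ∨ wr) (hwr' : ¬ (ww ∧ wr))
    (hzl : zz ∨ zl) (hzl' : ¬ (zz ∧ zl)) (hzr : zz ∨ zr) (hzr' : ¬ (zz ∧ zr))
    (hul : c ∨ wl ∨ ml ∨ uu) (hul₁ : ¬ (c ∧ wl)) (hul₂ : ¬ (c ∧ ml)) (hul₃ : ¬ (c ∧ uu))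
    (hul₄ : ¬ (wl ∧ ml)) (hul₅ : ¬ (wl ∧ uu)) (hul₆ : ¬ (ml ∧ uu))
    (hvl : d ∨ zl ∨ ml ∨ vv) (hvl₁ : ¬ (d ∧ zl)) (hvl₃ : ¬ (d ∧ vv))
    (hvl₄ : ¬ (zl ∧ ml)) (hvl₅ : ¬ (zl ∧ vv)) (hvl₆ : ¬ (ml ∧ vv))
    (hur : wr ∨ mr ∨ uu ∨ cu) (hur₁ : ¬ (wr ∧ mr)) (hur₃ : ¬ (wr ∧ cu))
    (hur₄ : ¬ (mr ∧ uu)) (hur₅ : ¬ (mr ∧ cu)) (hur₆ : ¬ (uu ∧ cu))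
    (hvr : zr ∨ mr ∨ vv ∨ cv) (hvr₁ : ¬ (zr ∧ mr)) (hvr₃ : ¬ (zr ∧ cv))
    (hvr₅ : ¬ (mr ∧ cv)) (hvr₆ : ¬ (vv ∧ cv)) (hcd : c ↔ d) :
    (cu ↔ cv) ∧
    ((c ∧ ¬ ml ∧ ww ∧ zz ∧ ¬ wl ∧ ¬ zl ∧ (mr ∨ cu)) ∨
     (¬ c ∧ ml ∧ ww ∧ zz ∧ ¬ wl ∧ ¬ zl ∧ (mr ∨ cu)) ∨
     (¬ c ∧ ¬ ml ∧ ¬ mr ∧ ¬ cu ∧ (wl ∧ wr ∧ ¬ ww ∧ ¬ uu ∨ ww ∧ uu ∧ ¬ wl ∧ ¬ wr) ∧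
      (zl ∧ zr ∧ ¬ zz ∧ ¬ vv ∨ zz ∧ vv ∧ ¬ zl ∧ ¬ zr))) := by
  by_cases ww <;> by_cases zz <;> by_cases c <;> by_cases ml <;> simp_all <;> grind

/-- Adjacency in a subgraph of the polyomino, as a relation on labels of vertices. -/
def Joined {n : ℕ} (M : (polyomino n).Subgraph) (p q : Row × ℕ) : Prop :=
  ∃ (hp : p ∈ verts n) (hq : q ∈ verts n), M.Adj ⟨p, hp⟩ ⟨q, hq⟩

section Joined

variable {n : ℕ} {M : (polyomino n).Subgraph}

theorem Joined.symm {p q : Row × ℕ} (h : Joined M p q) : Joined M q p := by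
  obtain ⟨hp, hq, h⟩ := h
  exact ⟨hq, hp, h.symm⟩

theorem Joined.unique (hM : M.IsPerfectMatching) {p q q' : Row × ℕ} (h : Joined M p q)
    (h' : Joined M p q') : q = q' := by
  obtain ⟨hp, hq, h⟩ := h
  obtain ⟨_, hq', h'⟩ := h'
  exact congrArg Subtype.val ((SimpleGraph.Subgraph.isPerfectMatching_iff.1 hM ⟨p, hp⟩).unique h h')

theorem exists_joined (hM : M.IsPerfectMatching) {p : Row × ℕ} (hp : p ∈ verts n) :
    ∃ q, Joined M p q := by
  obtain ⟨q, hq, -⟩ := SimpleGraph.Subgraph.isPerfectMatching_iff.1 hM ⟨p, hp⟩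
  exact ⟨q, hp, q.2, hq⟩

theorem Joined.edge {p q : Row × ℕ} (h : Joined M p q) : Edge p q ∨ Edge q p := by
  obtain ⟨hp, hq, h⟩ := h
  exact M.adj_sub h

theorem Joined.w_odd {k : ℕ} {q : Row × ℕ} (h : Joined M (.w, 2 * k + 1) q) :
    q = (.w, 2 * k + 2) ∨ q = (.u, 2 * k + 1) := by
  rcases h.edge with h | h
  · cases h <;> simp
  · generalize hp : (Row.w, 2 * k + 1) = p at h
    cases h <;> simp_all
    grind

theorem Joined.w_even {k : ℕ} {q : Row × ℕ} (h : Joined M (.w, 2 * k + 2) q) :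
    q = (.w, 2 * k + 1) ∨ q = (.u, 2 * k + 2) := by
  rcases h.edge with h | h
  · generalize hp : (Row.w, 2 * k + 2) = p at h
    cases h <;> simp_all
    grind
  · cases h <;> simp

theorem Joined.z_odd {k : ℕ} {q : Row × ℕ} (h : Joined M (.z, 2 * k + 1) q) :
    q = (.z, 2 * k + 2) ∨ q = (.v, 2 * k + 1) := by
  rcases h.edge with h | h
  · cases h <;> simp
  · generalize hp : (Row.z, 2 * k + 1) = p at h
    cases h <;> simp_all
    grind

theorem Joined.z_even {k : ℕ} {q : Row × ℕ} (h : Joined M (.z, 2 * k + 2) q) :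
    q = (.z, 2 * k + 1) ∨ q = (.v, 2 * k + 2) := by
  rcases h.edge with h | h
  · generalize hp : (Row.z, 2 * k + 2) = p at h
    cases h <;> simp_all
    grind
  · cases h <;> simp

theorem Joined.u_succ {i : ℕ} {q : Row × ℕ} (h : Joined M (.u, i + 1) q) :
    q = (.u, i) ∨ q = (.w, i + 1) ∨ q = (.v, i + 1) ∨ q = (.u, i + 2) := by
  rcases h.edge with h | h <;> cases h <;> simp

theorem Joined.v_succ {i : ℕ} {q : Row × ℕ} (h : Joined M (.v, i + 1) q) :
    q = (.v, i) ∨ q = (.z, i + 1) ∨ q = (.u, i + 1) ∨ q = (.v, i + 2) := by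
  rcases h.edge with h | h <;> cases h <;> simp

theorem Joined.u_zero {q : Row × ℕ} (h : Joined M (.u, 0) q) : q = (.v, 0) ∨ q = (.u, 1) := by
  obtain ⟨-, hq, -⟩ := id h
  rcases h.edge with h | h <;> cases h <;> simp [verts] at hq ⊢

theorem Joined.v_zero {q : Row × ℕ} (h : Joined M (.v, 0) q) : q = (.u, 0) ∨ q = (.v, 1) := by
  obtain ⟨-, hq, -⟩ := id h
  rcases h.edge with h | h <;> cases h <;> simp [verts] at hq ⊢

/-- Each of the eight vertices of the pair of columns has exactly one matching edge, and
`block_cases` settles the resulting propositional problem. The three alternatives are the letters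
`link true`, `link false` and `split`; the equivalence carries the hypothesis `hcd` on to the next
pair. -/
theorem joined_block (hM : M.IsPerfectMatching) {k : ℕ} (hk : k < n)
    (hcd : Joined M (.u, 2 * k) (.u, 2 * k + 1) ↔ Joined M (.v, 2 * k) (.v, 2 * k + 1)) :
    (Joined M (.u, 2 * k + 2) (.u, 2 * k + 3) ↔ Joined M (.v, 2 * k + 2) (.v, 2 * k + 3)) ∧
    ((Joined M (.u, 2 * k) (.u, 2 * k + 1) ∧ ¬ Joined M (.u, 2 * k + 1) (.v, 2 * k + 1) ∧
        Joined M (.w, 2 * k + 1) (.w, 2 * k + 2) ∧ Joined M (.z, 2 * k + 1) (.z, 2 * k + 2) ∧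
        ¬ Joined M (.w, 2 * k + 1) (.u, 2 * k + 1) ∧ ¬ Joined M (.z, 2 * k + 1) (.v, 2 * k + 1) ∧
        (Joined M (.u, 2 * k + 2) (.v, 2 * k + 2) ∨ Joined M (.u, 2 * k + 2) (.u, 2 * k + 3))) ∨
      (¬ Joined M (.u, 2 * k) (.u, 2 * k + 1) ∧ Joined M (.u, 2 * k + 1) (.v, 2 * k + 1) ∧
        Joined M (.w, 2 * k + 1) (.w, 2 * k + 2) ∧ Joined M (.z, 2 * k + 1) (.z, 2 * k + 2) ∧
        ¬ Joined M (.w, 2 * k + 1) (.u, 2 * k + 1) ∧ ¬ Joined M (.z, 2 * k + 1) (.v, 2 * k + 1) ∧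
        (Joined M (.u, 2 * k + 2) (.v, 2 * k + 2) ∨ Joined M (.u, 2 * k + 2) (.u, 2 * k + 3))) ∨
      (¬ Joined M (.u, 2 * k) (.u, 2 * k + 1) ∧ ¬ Joined M (.u, 2 * k + 1) (.v, 2 * k + 1) ∧
        ¬ Joined M (.u, 2 * k + 2) (.v, 2 * k + 2) ∧ ¬ Joined M (.u, 2 * k + 2) (.u, 2 * k + 3) ∧
        (Joined M (.w, 2 * k + 1) (.u, 2 * k + 1) ∧ Joined M (.w, 2 * k + 2) (.u, 2 * k + 2) ∧
            ¬ Joined M (.w, 2 * k + 1) (.w, 2 * k + 2) ∧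
            ¬ Joined M (.u, 2 * k + 1) (.u, 2 * k + 2) ∨
          Joined M (.w, 2 * k + 1) (.w, 2 * k + 2) ∧ Joined M (.u, 2 * k + 1) (.u, 2 * k + 2) ∧
            ¬ Joined M (.w, 2 * k + 1) (.u, 2 * k + 1) ∧
            ¬ Joined M (.w, 2 * k + 2) (.u, 2 * k + 2)) ∧
        (Joined M (.z, 2 * k + 1) (.v, 2 * k + 1) ∧ Joined M (.z, 2 * k + 2) (.v, 2 * k + 2) ∧
            ¬ Joined M (.z, 2 * k + 1) (.z, 2 * k + 2) ∧
            ¬ Joined M (.v, 2 * k + 1) (.v, 2 * k + 2) ∨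
          Joined M (.z, 2 * k + 1) (.z, 2 * k + 2) ∧ Joined M (.v, 2 * k + 1) (.v, 2 * k + 2) ∧
            ¬ Joined M (.z, 2 * k + 1) (.v, 2 * k + 1) ∧
            ¬ Joined M (.z, 2 * k + 2) (.v, 2 * k + 2)))) := by
  have hmem : ∀ r i, 1 ≤ i → i ≤ 2 * n → (r, i) ∈ verts n := fun r i h1 h2 =>
    ⟨by omega, h2, fun _ => h1⟩
  have hwl : Joined M (.w, 2 * k + 1) (.w, 2 * k + 2) ∨ Joined M (.w, 2 * k + 1) (.u, 2 * k + 1) := by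
    obtain ⟨q, hq⟩ := exists_joined hM (hmem .w (2 * k + 1) (by omega) (by omega))
    rcases hq.w_odd with rfl | rfl <;> simp [hq]
  have hwr : Joined M (.w, 2 * k + 1) (.w, 2 * k + 2) ∨ Joined M (.w, 2 * k + 2) (.u, 2 * k + 2) := by
    obtain ⟨q, hq⟩ := exists_joined hM (hmem .w (2 * k + 2) (by omega) (by omega))
    rcases hq.w_even with rfl | rfl <;> simp [hq, hq.symm]
  have hzl : Joined M (.z, 2 * k + 1) (.z, 2 * k + 2) ∨ Joined M (.z, 2 * k + 1) (.v, 2 * k + 1) := by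
    obtain ⟨q, hq⟩ := exists_joined hM (hmem .z (2 * k + 1) (by omega) (by omega))
    rcases hq.z_odd with rfl | rfl <;> simp [hq]
  have hzr : Joined M (.z, 2 * k + 1) (.z, 2 * k + 2) ∨ Joined M (.z, 2 * k + 2) (.v, 2 * k + 2) := by
    obtain ⟨q, hq⟩ := exists_joined hM (hmem .z (2 * k + 2) (by omega) (by omega))
    rcases hq.z_even with rfl | rfl <;> simp [hq, hq.symm]
  have hul : Joined M (.u, 2 * k) (.u, 2 * k + 1) ∨ Joined M (.w, 2 * k + 1) (.u, 2 * k + 1) ∨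
      Joined M (.u, 2 * k + 1) (.v, 2 * k + 1) ∨ Joined M (.u, 2 * k + 1) (.u, 2 * k + 2) := by
    obtain ⟨q, hq⟩ := exists_joined hM (hmem .u (2 * k + 1) (by omega) (by omega))
    rcases hq.u_succ with rfl | rfl | rfl | rfl <;> simp [hq, hq.symm]
  have hvl : Joined M (.v, 2 * k) (.v, 2 * k + 1) ∨ Joined M (.z, 2 * k + 1) (.v, 2 * k + 1) ∨
      Joined M (.u, 2 * k + 1) (.v, 2 * k + 1) ∨ Joined M (.v, 2 * k + 1) (.v, 2 * k + 2) := by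
    obtain ⟨q, hq⟩ := exists_joined hM (hmem .v (2 * k + 1) (by omega) (by omega))
    rcases hq.v_succ with rfl | rfl | rfl | rfl <;> simp [hq, hq.symm]
  have hur : Joined M (.w, 2 * k + 2) (.u, 2 * k + 2) ∨ Joined M (.u, 2 * k + 2) (.v, 2 * k + 2) ∨
      Joined M (.u, 2 * k + 1) (.u, 2 * k + 2) ∨ Joined M (.u, 2 * k + 2) (.u, 2 * k + 3) := by
    obtain ⟨q, hq⟩ := exists_joined hM (hmem .u (2 * k + 2) (by omega) (by omega))
    rcases hq.u_succ with rfl | rfl | rfl | rfl <;> simp [hq, hq.symm]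
  have hvr : Joined M (.z, 2 * k + 2) (.v, 2 * k + 2) ∨ Joined M (.u, 2 * k + 2) (.v, 2 * k + 2) ∨
      Joined M (.v, 2 * k + 1) (.v, 2 * k + 2) ∨ Joined M (.v, 2 * k + 2) (.v, 2 * k + 3) := by
    obtain ⟨q, hq⟩ := exists_joined hM (hmem .v (2 * k + 2) (by omega) (by omega))
    rcases hq.v_succ with rfl | rfl | rfl | rfl <;> simp [hq, hq.symm]
  refine block_cases hwl ?_ hwr ?_ hzl ?_ hzr ?_ hul ?_ ?_ ?_ ?_ ?_ ?_ hvl ?_ ?_ ?_ ?_ ?_ hur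
    ?_ ?_ ?_ ?_ ?_ hvr ?_ ?_ ?_ ?_ hcd <;> rintro ⟨h₁, h₂⟩
  all_goals first
    | simpa using h₁.unique hM h₂
    | simpa using h₁.symm.unique hM h₂
    | simpa using h₁.unique hM h₂.symm
    | simpa using h₁.symm.unique hM h₂.symm

theorem not_joined_cut {k : ℕ} (hk : n ≤ k) (r r' : Row) :
    ¬ Joined M (r, 2 * k) (r', 2 * k + 1) := by
  rintro ⟨-, ⟨-, h, -⟩, -⟩
  simp at h
  omega

/-- Induction from the left end: in column 0, if one of `u_0`, `v_0` is matched to the right, the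
other has lost its only other neighbour. `joined_block` is the inductive step. -/
theorem joined_cut_iff (hM : M.IsPerfectMatching) (k : ℕ) :
    Joined M (.u, 2 * k) (.u, 2 * k + 1) ↔ Joined M (.v, 2 * k) (.v, 2 * k + 1) := by
  induction k with
  | zero =>
    rcases Nat.eq_zero_or_pos n with rfl | hn
    · exact iff_of_false (not_joined_cut le_rfl _ _) (not_joined_cut le_rfl _ _)
    obtain ⟨q, hq⟩ := exists_joined hM (p := (.u, 0)) ⟨hn, by simp, by simp⟩
    obtain ⟨q', hq'⟩ := exists_joined hM (p := (.v, 0)) ⟨hn, by simp, by simp⟩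
    constructor
    · intro h
      rcases hq'.v_zero with rfl | rfl
      · simpa using h.unique hM hq'.symm
      · exact hq'
    · intro h
      rcases hq.u_zero with rfl | rfl
      · simpa using h.unique hM hq.symm
      · exact hq
  | succ k ih =>
    rcases lt_or_ge k n with hk | hk
    · exact (joined_block hM hk ih).1
    · simp [not_joined_cut (show n ≤ k + 1 by omega)]

open Classical in
/-- The letter describing a perfect matching in a pair of columns. -/
noncomputable def readLetter (M : (polyomino n).Subgraph) (k : ℕ) : Letter :=
  if n ≤ k then link false
  else if Joined M (.u, 2 * k) (.u, 2 * k + 1) then link true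
  else if Joined M (.u, 2 * k + 1) (.v, 2 * k + 1) then link false
  else split (decide (Joined M (.w, 2 * k + 1) (.u, 2 * k + 1)))
    (decide (Joined M (.z, 2 * k + 1) (.v, 2 * k + 1)))

theorem readLetter_eq_link_true {k : ℕ} :
    readLetter M k = link true ↔ Joined M (.u, 2 * k) (.u, 2 * k + 1) := by
  unfold readLetter
  split_ifs with h1 h2 h3
  · simp [not_joined_cut h1]
  · simp [h2]
  · simp [h2]
  · simp [h2]

open Classical in
theorem readLetter_of_lt {k : ℕ} (hk : k < n) : readLetter M k =
    if Joined M (.u, 2 * k) (.u, 2 * k + 1) then link true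
    else if Joined M (.u, 2 * k + 1) (.v, 2 * k + 1) then link false
    else split (decide (Joined M (.w, 2 * k + 1) (.u, 2 * k + 1)))
      (decide (Joined M (.z, 2 * k + 1) (.v, 2 * k + 1))) :=
  if_neg (not_le.2 hk)

theorem joined_mate (hM : M.IsPerfectMatching) {p : Row × ℕ} (hp : p ∈ verts n) :
    Joined M p (mate (readLetter M) p) := by
  obtain ⟨r, i⟩ := p
  obtain ⟨q, hq⟩ := exists_joined hM hp
  rcases column_cases i with rfl | ⟨k, rfl⟩ | ⟨k, rfl⟩
  · have h := joined_cut_iff hM 0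
    have h0 := readLetter_eq_link_true (M := M) (k := 0)
    simp only [Nat.mul_zero, Nat.zero_add] at h h0
    cases r
    · simp [verts] at hp
    · rw [mate_u_zero]
      split_ifs with h1 <;> rw [h0] at h1
      · exact h1
      · rcases hq.u_zero with rfl | rfl
        · exact hq
        · exact absurd hq h1
    · rw [mate_v_zero]
      split_ifs with h1 <;> rw [h0] at h1
      · exact h.1 h1
      · rcases hq.v_zero with rfl | rfl
        · exact hq
        · exact absurd (h.2 hq) h1
    · simp [verts] at hp
  all_goals
    have hk : k < n := by have := hp.2.1; simp at this; omega
    have hcut := joined_cut_iff hM k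
    obtain ⟨hcut', h⟩ := joined_block hM hk hcut
    have hnext := readLetter_eq_link_true (M := M) (k := k + 1)
    rw [show 2 * (k + 1) + 1 = 2 * k + 3 by ring, show 2 * (k + 1) = 2 * k + 2 by ring] at hnext
    rcases h with ⟨h1, h2, h3, h4, h5, h6, h7⟩ | ⟨h1, h2, h3, h4, h5, h6, h7⟩ |
      ⟨h1, h2, h3, h4, ⟨h5, h6, h7, h8⟩ | ⟨h5, h6, h7, h8⟩, ⟨h9, h10, h11, h12⟩ | ⟨h9, h10, h11, h12⟩⟩
    all_goals
      have hread := readLetter_of_lt (M := M) hk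
      simp only [*, if_true, if_false, decide_true, decide_false] at hread
      cases r
    all_goals
      simp only [mate_w_odd, mate_w_even, mate_z_odd, mate_z_even, mate_u_odd, mate_u_even,
        mate_v_odd, mate_v_even, Letter.top, Letter.bot, hread]
      grind [Joined.symm]

theorem readLetter_valid (hM : M.IsPerfectMatching) : Valid (readLetter M) := by
  intro k t b h
  rw [Ne, readLetter_eq_link_true]
  rcases le_or_gt n k with hk | hk
  · exact not_joined_cut (by omega) _ _
  · rw [readLetter_of_lt hk] at h
    split_ifs at h with h1 h2
    have := (joined_block hM hk (joined_cut_iff hM k)).2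
    rw [show 2 * (k + 1) + 1 = 2 * k + 3 by ring, show 2 * (k + 1) = 2 * k + 2 by ring]
    tauto

theorem readLetter_of_le {k : ℕ} (hk : n ≤ k) : readLetter M k = link false := if_pos hk

theorem wordMatching_readLetter (hM : M.IsPerfectMatching) :
    wordMatching (readLetter M) n = M := by
  have hn : ∀ k, n ≤ k → readLetter M k ≠ link true := fun k hk => by simp [readLetter_of_le hk]
  have ha := readLetter_valid hM
  refine eq_of_isPerfectMatching (wordMatching_isPerfectMatching ha hn) hM fun p => ?_
  obtain ⟨_, hq, h⟩ := joined_mate hM p.2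
  exact ⟨_, (wordMatching_adj ha hn).2 rfl, h⟩

end Joined

/-- The six letters give six different pairs of partners to `u_{2k+1}` and `v_{2k+1}`. -/
theorem letter_eq_of_mate_eq {a b : ℕ → Letter} {k : ℕ}
    (hu : mate a (.u, 2 * k + 1) = mate b (.u, 2 * k + 1))
    (hv : mate a (.v, 2 * k + 1) = mate b (.v, 2 * k + 1)) : a k = b k := by
  rw [mate_u_odd, mate_u_odd] at hu
  rw [mate_v_odd, mate_v_odd] at hv
  generalize a k = x at *
  generalize b k = y at *
  rcases x with ⟨_ | _, _ | _⟩ | ⟨_ | _⟩ <;> rcases y with ⟨_ | _, _ | _⟩ | ⟨_ | _⟩ <;>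
    simp at hu hv ⊢

/-- For a `link` one vertex suffices: its partner of `u_{2k+1}`, namely `u_{2k}` or `v_{2k+1}`,
arises from no other letter. This is why a `link` costs at most one edge. -/
theorem letter_eq_of_link_of_mate_eq {a b : ℕ → Letter} {k : ℕ} {c : Bool} (h : a k = link c)
    (hu : mate a (.u, 2 * k + 1) = mate b (.u, 2 * k + 1)) : a k = b k := by
  rw [mate_u_odd, mate_u_odd, h] at hu
  rw [h]
  generalize b k = y at *
  rcases y with ⟨_ | _, _ | _⟩ | ⟨_ | _⟩ <;> cases c <;> simp at hu ⊢

theorem wordMatching_injective {a b : ℕ → Letter} (ha : Valid a) (hb : Valid b) {n : ℕ}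
    (han : ∀ k, n ≤ k → a k = link false) (hbn : ∀ k, n ≤ k → b k = link false)
    (h : wordMatching a n = wordMatching b n) : a = b := by
  have han' : ∀ k, n ≤ k → a k ≠ link true := fun k hk => by simp [han k hk]
  have hbn' : ∀ k, n ≤ k → b k ≠ link true := fun k hk => by simp [hbn k hk]
  funext k
  rcases le_or_gt n k with hk | hk
  · rw [han k hk, hbn k hk]
  · have key : ∀ r, mate a (r, 2 * k + 1) = mate b (r, 2 * k + 1) := by
      intro r
      have hp : (r, 2 * k + 1) ∈ verts n := ⟨by omega, by simp; omega, by simp⟩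
      have h1 : (wordMatching a n).Adj ⟨_, hp⟩ ⟨_, (mate_spec ha han' hp).1⟩ :=
        (wordMatching_adj ha han').2 rfl
      rw [h] at h1
      exact ((wordMatching_adj hb hbn').1 h1).symm
    exact letter_eq_of_mate_eq (key .u) (key .v)

/-! ### The automaton, its squares and the edges picked from them. -/

/-- The states of the automaton computing forcing numbers. A maximal run of `link`s is read in
state `cut` if it is not preceded by a `split`; otherwise it is entered in state `start`, and
continued in state `mid` if it has no `link true`, and else in state `wait` until the first
`link true` and in state `cut` from then on. -/
inductive Mode
  | cut | start | mid | wait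
  deriving DecidableEq

/-- The transitions of the automaton. -/
def Step (s : Mode) : Letter → Mode → Prop
  | split _ _, s' => s ≠ .wait ∧ s' = .start
  | link true, s' => (s = .cut ∨ s = .wait) ∧ s' = .cut
  | link false, s' => s = .start ∧ (s' = .mid ∨ s' = .wait) ∨ s ≠ .start ∧ s' = s

/-- The number of edges of a minimum forcing set that a step accounts for. -/
def stepCost (s : Mode) : Letter → Mode → ℕ
  | .split _ _, _ => 2
  | .link _, s' => if s = .start ∧ s' = .wait then 0 else 1

/-- A run of the automaton on a word of length `n`. -/
structure IsRun (n : ℕ) (a : ℕ → Letter) (st : ℕ → Mode) : Prop where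
  step : ∀ k, k < n → Step (st k) (a k) (st (k + 1))
  eq_link : ∀ k, n ≤ k → a k = link false
  last : st n ≠ .wait

/-- The squares used for the lower bound: a square is indexed by the pair of columns it belongs to
and, for a `split`, by whether it is the upper or the lower square. -/
def squares (n : ℕ) (a : ℕ → Letter) (st : ℕ → Mode) : Finset ((_ : ℕ) × ℕ) :=
  (Finset.range n).sigma fun k => Finset.range (stepCost (st k) (a k) (st (k + 1)))

/-- Membership of a vertex in a square. -/
def InSquare (a : ℕ → Letter) (st : ℕ → Mode) (p : Row × ℕ) (t : (_ : ℕ) × ℕ) : Prop :=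
  match a t.1 with
  | split _ _ => (p.2 = 2 * t.1 + 1 ∨ p.2 = 2 * t.1 + 2) ∧
      (t.2 = 0 ∧ (p.1 = .w ∨ p.1 = .u) ∨ t.2 = 1 ∧ (p.1 = .v ∨ p.1 = .z))
  | link _ => t.2 = 0 ∧ (p.1 = .u ∨ p.1 = .v) ∧
      (if st (t.1 + 1) = .mid then p.2 = 2 * t.1 + 1 ∨ p.2 = 2 * t.1 + 2
        else p.2 = 2 * t.1 ∨ p.2 = 2 * t.1 + 1)

/-- The vertex at which the matching edge of a square is put into the forcing set. -/
def pick (st : ℕ → Mode) (t : (_ : ℕ) × ℕ) : Row × ℕ :=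
  if t.2 = 1 then (.v, 2 * t.1 + 1)
  else if st (t.1 + 1) = .wait then (.u, 2 * t.1) else (.u, 2 * t.1 + 1)

section Run

variable {n : ℕ} {a : ℕ → Letter} {st : ℕ → Mode}

theorem IsRun.eq_start (h : IsRun n a st) {k : ℕ} {t b : Bool} (hk : a k = split t b) :
    k < n ∧ st (k + 1) = .start := by
  rcases lt_or_ge k n with hkn | hkn
  · have := h.step k hkn
    rw [hk] at this
    exact ⟨hkn, this.2⟩
  · rw [h.eq_link k hkn] at hk
    cases hk

theorem IsRun.eq_split (h : IsRun n a st) {k : ℕ} (hkn : k < n) (hk : st (k + 1) = .start) :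
    ∃ t b, a k = split t b := by
  have := h.step k hkn
  rcases hak : a k with ⟨t, b⟩ | ⟨_ | _⟩
  · exact ⟨t, b, rfl⟩
  · simp [Step, hak, hk] at this
    exact absurd this.2.symm this.1
  · simp [Step, hak, hk] at this

theorem IsRun.eq_link_of_wait (h : IsRun n a st) {k : ℕ} (hkn : k < n)
    (hk : st (k + 1) = .wait) : a k = link false ∧ (st k = .start ∨ st k = .wait) := by
  have := h.step k hkn
  rcases hak : a k with ⟨t, b⟩ | ⟨_ | _⟩ <;> simp [Step, hak, hk] at this ⊢
  rcases this with h | h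
  · exact Or.inl h
  · exact Or.inr h.2.symm

theorem IsRun.valid (h : IsRun n a st) : Valid a := by
  intro k t b hk hk'
  obtain ⟨hkn, hst⟩ := h.eq_start hk
  rcases lt_or_ge (k + 1) n with hkn' | hkn'
  · have := h.step (k + 1) hkn'
    simp [hk', hst, Step] at this
  · simp [h.eq_link _ hkn'] at hk'

theorem mem_squares {t : (_ : ℕ) × ℕ} : t ∈ squares n a st ↔
    t.1 < n ∧ t.2 < stepCost (st t.1) (a t.1) (st (t.1 + 1)) := by
  simp [squares]

theorem isLink_of_mate_u_even {k : ℕ}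
    (h : mate a (.u, 2 * k + 2) = (.v, 2 * k + 2)) : ∃ c, a k = link c := by
  rw [mate_u_even] at h
  rcases hak : a k with ⟨_ | _, _⟩ | c
  · split_ifs at h <;> simp [hak] at h
  · split_ifs at h <;> simp [hak] at h
  · exact ⟨c, rfl⟩

/-- The edge picked at the next letter does it. If that letter is `link false`, the picked edge is
the vertical one in column `2k+2`, which no `split` at `k` allows; if it is `link true`, `b` has it
too, and `Valid` forbids a `split` before it. -/
theorem IsRun.isLink_of_wait (h : IsRun n a st) {b : ℕ → Letter} (hb : Valid b)
    (hab : ∀ t ∈ squares n a st, mate a (pick st t) = mate b (pick st t)) {k : ℕ} (hkn : k < n)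
    (hk : st (k + 1) = .wait) : ∃ c, b k = link c := by
  have hkn' : k + 1 < n := by
    by_contra hcon
    obtain rfl : n = k + 1 := by omega
    exact h.last hk
  obtain ⟨hak, -⟩ := h.eq_link_of_wait hkn hk
  have hstep := h.step (k + 1) hkn'
  rcases hak' : a (k + 1) with ⟨t, b⟩ | ⟨_ | _⟩
  · simp [hak', Step, hk] at hstep
  · simp only [hak', Step, hk] at hstep
    have hst : st (k + 2) = .wait := by simpa using hstep
    have hpick := hab ⟨k + 1, 0⟩ (mem_squares.2 ⟨hkn', by simp [stepCost, hak', hk]⟩)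
    simp only [pick, hst, zero_ne_one, if_true, if_false,
      show 2 * (k + 1) = 2 * k + 2 by ring] at hpick
    refine isLink_of_mate_u_even (hpick.symm.trans ?_)
    simp [mate_u_even, hak, hak']
  · simp only [hak', Step, hk] at hstep
    have hst : st (k + 2) = .cut := by simpa using hstep
    have hpick := hab ⟨k + 1, 0⟩ (mem_squares.2 ⟨hkn', by simp [stepCost, hak', hk]⟩)
    have := letter_eq_of_link_of_mate_eq hak' (by simpa [pick, hst] using hpick)
    rcases hbk : b k with ⟨t, b'⟩ | c
    · exact absurd (this.symm.trans hak') (hb k t b' hbk)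
    · exact ⟨c, rfl⟩

/-- The word is recovered from left to right. A `split` is fixed by its two picks, a `link` not
entering `wait` by its single pick in column `2k+1`. A letter entering `wait` is known to be a
`link` from its right neighbour, and it remains to exclude `link true` from the left. -/
theorem IsRun.eq_of_mate_eq (h : IsRun n a st) (h0 : st 0 = .cut) {b : ℕ → Letter} (hb : Valid b)
    (hbn : ∀ k, n ≤ k → b k = link false)
    (hab : ∀ t ∈ squares n a st, mate a (pick st t) = mate b (pick st t)) : b = a := by
  funext k
  induction k using Nat.strong_induction_on with
  | _ k ih =>
  rcases le_or_gt n k with hkn | hkn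
  · rw [hbn k hkn, h.eq_link k hkn]
  have hstep := h.step k hkn
  rcases hak : a k with ⟨t, c⟩ | c
  · have hst := (h.eq_start hak).2
    have h1 := hab ⟨k, 0⟩ (mem_squares.2 ⟨hkn, by simp [hak, stepCost]⟩)
    have h2 := hab ⟨k, 1⟩ (mem_squares.2 ⟨hkn, by simp [hak, stepCost]⟩)
    rw [← hak]
    exact (letter_eq_of_mate_eq (by simpa [pick, hst] using h1) (by simpa [pick] using h2)).symm
  by_cases hst : st (k + 1) = .wait
  · obtain ⟨hak', hst'⟩ := h.eq_link_of_wait hkn hst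
    obtain ⟨c', hc'⟩ := h.isLink_of_wait hb hab hkn hst
    rw [← hak, hak', hc']
    cases c' with
    | false => rfl
    | true =>
      exfalso
      cases k with
      | zero => simp [h0] at hst'
      | succ k =>
        rcases hst' with hst' | hst'
        -- First `link` of the run, without a pick: the preceding `split`, already recovered in `b`,
        -- excludes `link true`.
        · obtain ⟨t, b', hs⟩ := h.eq_split (by omega) hst'
          exact hb k t b' ((ih k (by omega)).trans hs) hc'
        -- Later `link` of the run: its pick is the vertical edge in its left boundary column, which
        -- `link true` would not leave in place.
        · have h1 := hab ⟨k + 1, 0⟩ (mem_squares.2 ⟨hkn, by simp [hak', stepCost, hst']⟩)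
          obtain ⟨hs, -⟩ := h.eq_link_of_wait (by omega) hst'
          simp [pick, hst, show 2 * (k + 1) = 2 * k + 2 by ring, mate_u_even, hak', hs, hc'] at h1
  · have h1 := hab ⟨k, 0⟩ (mem_squares.2 ⟨hkn, by simp [hak, stepCost, hst]⟩)
    rw [← hak]
    exact (letter_eq_of_link_of_mate_eq hak (by simpa [pick, hst] using h1)).symm

theorem inSquare_column {p : Row × ℕ} {t : (_ : ℕ) × ℕ} (hp : InSquare a st p t) :
    2 * t.1 ≤ p.2 ∧ p.2 ≤ 2 * t.1 + 2 := by
  unfold InSquare at hp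
  split at hp
  · omega
  · split_ifs at hp <;> omega

/-- Squares of different pairs can share only column `2k+2`. The left one reaches it only if the
state after letter `k` is `start` or `mid`. From there a `link` either stays within its own two
columns (`mid`) or enters `wait` from `start`, at cost 0 and so without a square. -/
theorem inSquare_not_lt (h : IsRun n a st) {p : Row × ℕ} {t t' : (_ : ℕ) × ℕ}
    (ht : t ∈ squares n a st) (ht' : t' ∈ squares n a st) (hp : InSquare a st p t)
    (hp' : InSquare a st p t') : ¬ t.1 < t'.1 := by
  intro hlt
  have h1 := inSquare_column hp
  have h2 := inSquare_column hp'
  obtain ⟨k, i⟩ := t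
  obtain ⟨k', j⟩ := t'
  simp only at hlt h1 h2
  obtain rfl : k' = k + 1 := by omega
  obtain ⟨r, c⟩ := p
  obtain rfl : c = 2 * k + 2 := by simp only at h1 h2; omega
  rw [mem_squares] at ht ht'
  simp only at ht ht'
  have hs' := h.step (k + 1) ht'.1
  have hst : st (k + 1) = .start ∨ st (k + 1) = .mid := by
    rcases hak : a k with ⟨x, y⟩ | x
    · exact Or.inl (h.eq_start hak).2
    · simp only [InSquare, hak] at hp
      by_contra! hcon
      simp only [hcon.2, if_false] at hp
      omega
  rcases hak : a (k + 1) with ⟨x, y⟩ | ⟨_ | _⟩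
  · simp only [InSquare, hak] at hp'
    omega
  · simp only [InSquare, hak] at hp'
    simp only [hak, stepCost] at ht'
    simp only [hak, Step] at hs'
    have hmid : st (k + 1 + 1) = .mid := by
      rcases hst with hst | hst <;> simp only [hst] at hs' ht'
      · rcases hs' with ⟨-, hs' | hs'⟩ | hs'
        · exact hs'
        · simp [hs'] at ht'
        · simp at hs'
      · simpa using hs'
    simp only [hmid, if_true] at hp'
    omega
  · simp only [hak, Step] at hs'
    rcases hst with hst | hst <;> simp [hst] at hs'

theorem inSquare_unique (h : IsRun n a st) {p : Row × ℕ} {t t' : (_ : ℕ) × ℕ}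
    (ht : t ∈ squares n a st) (ht' : t' ∈ squares n a st) (hp : InSquare a st p t)
    (hp' : InSquare a st p t') : t = t' := by
  have h1 := inSquare_not_lt h ht ht' hp hp'
  have h2 := inSquare_not_lt h ht' ht hp' hp
  obtain ⟨k, i⟩ := t
  obtain ⟨k', j⟩ := t'
  obtain rfl : k = k' := by simp only at h1 h2; omega
  obtain rfl : i = j := by
    unfold InSquare at hp hp'
    rcases hak : a k with ⟨x, y⟩ | x <;> simp only [hak] at hp hp'
    · obtain ⟨r, c⟩ := p
      cases r <;> simp at hp hp' <;> omega
    · omega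
  rfl

/-! ### Flipping a single square. -/

theorem valid_update (ha : Valid a) {k : ℕ} {x : Letter}
    (h1 : ∀ t b, x = split t b → a (k + 1) ≠ link true)
    (h2 : ∀ j t b, k = j + 1 → a j = split t b → x ≠ link true) :
    Valid (Function.update a k x) := by
  intro j t b hj
  by_cases hjk : j = k
  · subst hjk
    simpa using h1 t b (by simpa using hj)
  · rw [Function.update_of_ne hjk] at hj
    by_cases hjk' : j + 1 = k
    · rw [hjk', Function.update_self]
      exact h2 j t b hjk'.symm hj
    · rw [Function.update_of_ne hjk']
      exact ha j t b hj

theorem mate_update_top {k : ℕ} {t b t' : Bool} (hk : a k = split t b) {p : Row × ℕ}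
    (hpn : p ∈ verts n) (hp : ¬ ((p.2 = 2 * k + 1 ∨ p.2 = 2 * k + 2) ∧ (p.1 = .w ∨ p.1 = .u))) :
    mate (Function.update a k (split t' b)) p = mate a p := by
  obtain ⟨r, c⟩ := p
  have hpn := hpn.2.2
  rcases column_cases c with rfl | ⟨j, rfl⟩ | ⟨j, rfl⟩ <;> cases r <;>
    first
    | (simp at hpn; done)
    | (simp only [mate_w_odd, mate_w_even, mate_z_odd, mate_z_even, mate_u_odd, mate_u_even,
      mate_v_odd, mate_v_even, mate_u_zero, mate_v_zero, Function.update_apply]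
       grind [Letter.bot])

theorem mate_update_bot {k : ℕ} {t b b' : Bool} (hk : a k = split t b) {p : Row × ℕ}
    (hpn : p ∈ verts n) (hp : ¬ ((p.2 = 2 * k + 1 ∨ p.2 = 2 * k + 2) ∧ (p.1 = .v ∨ p.1 = .z))) :
    mate (Function.update a k (split t b')) p = mate a p := by
  obtain ⟨r, c⟩ := p
  have hpn := hpn.2.2
  rcases column_cases c with rfl | ⟨j, rfl⟩ | ⟨j, rfl⟩ <;> cases r <;>
    first
    | (simp at hpn; done)
    | (simp only [mate_w_odd, mate_w_even, mate_z_odd, mate_z_even, mate_u_odd, mate_u_even,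
      mate_v_odd, mate_v_even, mate_u_zero, mate_v_zero, Function.update_apply]
       grind [Letter.top])

/-- Unless `link true` follows, this flips the chain square in columns `2k+1`, `2k+2` from two
vertical edges to two horizontal ones. -/
theorem mate_update_mid {k : ℕ} (hk : a k = link false) {p : Row × ℕ}
    (hpn : p ∈ verts n) (hp : ¬ ((p.1 = .u ∨ p.1 = .v) ∧ (p.2 = 2 * k + 1 ∨ p.2 = 2 * k + 2))) :
    mate (Function.update a k (split false false)) p = mate a p := by
  obtain ⟨r, c⟩ := p
  have hpn := hpn.2.2
  rcases column_cases c with rfl | ⟨j, rfl⟩ | ⟨j, rfl⟩ <;> cases r <;>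
    first
    | (simp at hpn; done)
    | (simp only [mate_w_odd, mate_w_even, mate_z_odd, mate_z_even, mate_u_odd, mate_u_even,
      mate_v_odd, mate_v_even, mate_u_zero, mate_v_zero, Function.update_apply]
       grind [Letter.top, Letter.bot])

/-- Changing the Boolean of a `link` flips the chain square in columns `2k`, `2k+1`, provided that
no `split` precedes it. -/
theorem mate_update_cut {k : ℕ} {c c' : Bool} (hk : a k = link c) {p : Row × ℕ}
    (hpn : p ∈ verts n) (hp : ¬ ((p.1 = .u ∨ p.1 = .v) ∧ (p.2 = 2 * k ∨ p.2 = 2 * k + 1))) :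
    mate (Function.update a k (link c')) p = mate a p := by
  obtain ⟨r, i⟩ := p
  have hpn := hpn.2.2
  rcases column_cases i with rfl | ⟨j, rfl⟩ | ⟨j, rfl⟩ <;> cases r <;>
    first
    | (simp at hpn; done)
    | (simp only [mate_w_odd, mate_w_even, mate_z_odd, mate_z_even, mate_u_odd, mate_u_even,
      mate_v_odd, mate_v_even, mate_u_zero, mate_v_zero, Function.update_apply]
       grind [Letter.top, Letter.bot])

/-- Changing one letter flips the square: a Boolean of a `split` for its upper or lower square,
`link false` to `split false false` in state `mid`, the Boolean of a `link` otherwise. The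
transitions ensure that the new word is again valid. -/
theorem exists_flip (h : IsRun n a st) {t : (_ : ℕ) × ℕ} (ht : t ∈ squares n a st) :
    ∃ b, Valid b ∧ (∀ k, n ≤ k → b k = link false) ∧ b ≠ a ∧
      ∀ p ∈ verts n, ¬ InSquare a st p t → mate b p = mate a p := by
  obtain ⟨k, i⟩ := t
  rw [mem_squares] at ht
  obtain ⟨hkn, hi⟩ := ht
  simp only at hkn hi
  have hstep := h.step k hkn
  suffices hx : ∃ x, x ≠ a k ∧ (∀ t b, x = split t b → a (k + 1) ≠ link true) ∧
      (∀ j t b, k = j + 1 → a j = split t b → x ≠ link true) ∧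
      ∀ p ∈ verts n, ¬ InSquare a st p ⟨k, i⟩ → mate (Function.update a k x) p = mate a p by
    obtain ⟨x, hx1, hx2, hx3, hx4⟩ := hx
    refine ⟨_, valid_update h.valid hx2 hx3, fun j hj => ?_, fun heq => hx1 ?_, hx4⟩
    · rw [Function.update_of_ne (by omega), h.eq_link j hj]
    · rw [← heq, Function.update_self]
  rcases hak : a k with ⟨t, b⟩ | c
  · have hi' : i = 0 ∨ i = 1 := by simp only [hak, stepCost] at hi; omega
    rcases hi' with rfl | rfl
    · refine ⟨split (!t) b, by simp, fun _ _ _ => h.valid k t b hak, by simp, fun p hpn hp => ?_⟩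
      exact mate_update_top hak hpn (by simpa [InSquare, hak] using hp)
    · refine ⟨split t (!b), by simp, fun _ _ _ => h.valid k t b hak, by simp, fun p hpn hp => ?_⟩
      exact mate_update_bot hak hpn (by simpa [InSquare, hak] using hp)
  · have hi' : i = 0 := by simp only [hak, stepCost] at hi; split_ifs at hi <;> omega
    subst hi'
    by_cases hst : st (k + 1) = .mid
    · have hc : c = false := by
        cases c
        · rfl
        · simp [hak, Step, hst] at hstep
      subst hc
      refine ⟨split false false, by simp, fun _ _ _ hk' => ?_, by simp, fun p hpn hp => ?_⟩
      -- The state `mid` has no transition on `link true`, so the new `split` is not followed by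
      -- one.
      · rcases lt_or_ge (k + 1) n with hkn' | hkn'
        · have := h.step (k + 1) hkn'
          simp [hk', Step, hst] at this
        · simp [h.eq_link _ hkn'] at hk'
      · exact mate_update_mid hak hpn (by simpa [InSquare, hak, hst] using hp)
    · refine ⟨link (!c), by simp, by simp, fun j t b hkj hj => ?_, fun p hpn hp => ?_⟩
      · obtain ⟨-, hs⟩ := h.eq_start hj
        rw [← hkj] at hs
        cases c
        · simp only [hak, hs, Step] at hstep
          simp only [hak, hs, stepCost] at hi
          have hw : st (k + 1) = .wait := by simpa [hst] using hstep
          simp [hw] at hi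
        · simp
      · exact mate_update_cut hak hpn (by simpa [InSquare, hak, hst] using hp)

theorem pick_mem {t : (_ : ℕ) × ℕ} (ht : t ∈ squares n a st) :
    pick st t ∈ verts n := by
  have : t.1 < n := by simp [squares] at ht; exact ht.1
  unfold pick
  split_ifs <;> refine ⟨by omega, by simp; omega, by simp⟩

/-- Both bounds are indexed by `squares`: the picked edges give `≤`, the disjoint flips give `≥`. -/
theorem forcingNumber_wordMatching (h : IsRun n a st) (h0 : st 0 = .cut) :
    forcingNumber (wordMatching a n) =
      ∑ k ∈ Finset.range n, stepCost (st k) (a k) (st (k + 1)) := by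
  classical
  have hcard : (squares n a st).card =
      ∑ k ∈ Finset.range n, stepCost (st k) (a k) (st (k + 1)) := by
    simp [squares]
  have ha := h.valid
  have hn : ∀ k, n ≤ k → a k ≠ link true := fun k hk => by simp [h.eq_link k hk]
  have hM := wordMatching_isPerfectMatching ha hn
  rw [← hcard]
  apply le_antisymm
  · refine le_trans (forcingNumber_le_card hM
      (((squares n a st).image (pick st)).subtype (· ∈ verts n)) fun M' hM' hMM' => ?_) ?_
    · rw [← wordMatching_readLetter hM']
      have hb := readLetter_valid hM'
      have hbn : ∀ k, n ≤ k → readLetter M' k ≠ link true := fun k hk => by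
        simp [readLetter_of_le hk]
      congr 1
      refine h.eq_of_mate_eq h0 hb (fun k hk => readLetter_of_le hk) fun t ht => ?_
      have hp := pick_mem ht
      have h1 : (wordMatching a n).Adj ⟨_, hp⟩ ⟨_, (mate_spec ha hn hp).1⟩ :=
        (wordMatching_adj ha hn).2 rfl
      have h2 := hMM' ⟨_, hp⟩ (by simpa using ⟨t.1, t.2, ht, rfl⟩) _ h1
      rw [← wordMatching_readLetter hM'] at h2
      exact ((wordMatching_adj hb hbn).1 h2).symm
    · rw [Finset.card_subtype]
      exact (Finset.card_filter_le _ _).trans Finset.card_image_le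
  · refine card_le_forcingNumber hM _ (fun p t => InSquare a st p t)
      (fun p t ht t' ht' => inSquare_unique h ht ht') fun t ht => ?_
    obtain ⟨b, hb, hbn, hba, hagree⟩ := exists_flip h ht
    have hbn' : ∀ k, n ≤ k → b k ≠ link true := fun k hk => by simp [hbn k hk]
    refine ⟨wordMatching b n, wordMatching_isPerfectMatching hb hbn', fun heq => hba
      (wordMatching_injective hb ha hbn h.eq_link heq), fun p hp q hq => ?_⟩
    rw [wordMatching_adj ha hn] at hq
    rw [wordMatching_adj hb hbn', hagree p p.2 hp, hq]

end Run

/-! ### Finite words and their monomials. -/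

/-- The word with the given letters, continued by `link false`. -/
def toWord (l : List Letter) (k : ℕ) : Letter := l.getD k (link false)

theorem toWord_cons_zero (x : Letter) (l : List Letter) : toWord (x :: l) 0 = x := rfl

theorem toWord_of_le {l : List Letter} {k : ℕ} (h : l.length ≤ k) : toWord l k = link false := by
  simp [toWord, h]

theorem toWord_injective {l l' : List Letter} (hl : l.length = l'.length)
    (h : toWord l = toWord l') : l = l' := by
  refine List.ext_getElem hl fun k hk hk' => ?_
  have := congrFun h k
  simpa [toWord, hk, hk'] using this

theorem toWord_range_map {a : ℕ → Letter} {n : ℕ} (ha : ∀ k, n ≤ k → a k = link false) :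
    toWord ((List.range n).map a) = a := by
  funext k
  rcases lt_or_ge k n with hk | hk
  · simp [toWord, hk]
  · rw [ha k hk, toWord_of_le (by simpa using hk)]

theorem valid_toWord_nil : Valid (toWord []) := fun _ _ _ _ => by simp [toWord]

theorem valid_toWord_cons {x : Letter} {l : List Letter} : Valid (toWord (x :: l)) ↔
    (∀ t b, x = split t b → toWord l 0 ≠ link true) ∧ Valid (toWord l) := by
  constructor
  · intro h
    exact ⟨h 0, fun k => h (k + 1)⟩
  · rintro ⟨h0, h⟩ (_ | k)
    · exact h0
    · exact h k

/-- There is a run from state `s` on the given word, accounting for `c` edges. -/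
def HasRun (s : Mode) (l : List Letter) (c : ℕ) : Prop :=
  ∃ st, IsRun l.length (toWord l) st ∧ st 0 = s ∧
    ∑ k ∈ Finset.range l.length, stepCost (st k) (toWord l k) (st (k + 1)) = c

theorem HasRun.nil {s : Mode} (hs : s ≠ .wait) : HasRun s [] 0 :=
  ⟨fun _ => s, ⟨fun k hk => by simp at hk, fun k _ => by simp [toWord], hs⟩, rfl, by simp⟩

theorem HasRun.cons {s s' : Mode} {x : Letter} {l : List Letter} {c : ℕ} (h : HasRun s' l c)
    (hs : Step s x s') : HasRun s (x :: l) (c + stepCost s x s') := by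
  obtain ⟨st, hst, rfl, rfl⟩ := h
  refine ⟨fun k => Nat.casesOn k s st, ⟨?_, fun k hk => toWord_of_le hk, hst.last⟩, rfl, ?_⟩
  · rintro (_ | k) hk
    · exact hs
    · exact hst.step k (by simpa using hk)
  · rw [List.length_cons, Finset.sum_range_succ']
    rfl

/-- The states of a deterministic automaton computing forcing numbers; `free` merges `mid` and
`wait`. -/
inductive Phase
  | cut | start | free

/-- The monomial of the perfect matching described by a word, and `0` if there is none. -/
noncomputable def weight : Phase → List Letter → ℤ[X]
  | _, [] => 1
  | _, split _ _ :: l => X ^ 2 * weight .start l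
  | .cut, link _ :: l => X * weight .cut l
  | .start, link true :: _ => 0
  | .start, link false :: l => X * weight .free l
  | .free, link false :: l => X * weight .free l
  | .free, link true :: l => weight .cut l

/-- The three phases have to be treated together, by induction on the word. In phase `free` the
future decides which state is simulated: `mid` is charged exactly, whereas in `wait` one factor `X`
was paid in advance, at the first `link` of the run, and makes up for the free `link true`. -/
theorem weight_eq_pow (l : List Letter) (hl : Valid (toWord l)) :
    (∃ c, HasRun .cut l c ∧ weight .cut l = X ^ c) ∧
    (toWord l 0 ≠ link true → ∃ c, HasRun .start l c ∧ weight .start l = X ^ c) ∧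
    ∃ c, HasRun .mid l c ∧ weight .free l = X ^ c ∨ HasRun .wait l c ∧ X * weight .free l = X ^ c := by
  induction l with
  | nil =>
    exact ⟨⟨0, .nil (by simp), by simp [weight]⟩, fun _ => ⟨0, .nil (by simp), by simp [weight]⟩,
      0, Or.inl ⟨.nil (by simp), by simp [weight]⟩⟩
  | cons x l ih =>
    rw [valid_toWord_cons] at hl
    obtain ⟨⟨c, hc, hcw⟩, hstart, d, hd⟩ := ih hl.2
    rcases x with ⟨t, b⟩ | ⟨_ | _⟩
    · obtain ⟨e, he, hew⟩ := hstart (hl.1 t b rfl)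
      refine ⟨⟨_, he.cons (by simp [Step]), ?_⟩, fun _ => ⟨_, he.cons (by simp [Step]), ?_⟩,
        _, Or.inl ⟨he.cons (by simp [Step]), ?_⟩⟩ <;>
      · simp only [weight, hew, stepCost]
        ring
    · refine ⟨⟨_, hc.cons (by simp [Step]), ?_⟩, fun _ => ?_, ?_⟩
      · simp only [weight, hcw]
        simp [stepCost, pow_succ']
      · rcases hd with ⟨hd, hdw⟩ | ⟨hd, hdw⟩
        · refine ⟨_, hd.cons (by simp [Step]), ?_⟩
          simp only [weight, hdw]
          simp [stepCost, pow_succ']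
        · refine ⟨_, hd.cons (by simp [Step]), ?_⟩
          simp only [weight, hdw]
          simp [stepCost]
      · rcases hd with ⟨hd, hdw⟩ | ⟨hd, hdw⟩
        · refine ⟨_, Or.inl ⟨hd.cons (by simp [Step]), ?_⟩⟩
          simp only [weight, hdw]
          simp [stepCost, pow_succ']
        · refine ⟨_, Or.inr ⟨hd.cons (by simp [Step]), ?_⟩⟩
          simp only [weight, hdw]
          simp [stepCost, pow_succ']
    · refine ⟨⟨_, hc.cons (by simp [Step]), ?_⟩, fun h => absurd rfl h,
        _, Or.inr ⟨hc.cons (by simp [Step]), ?_⟩⟩ <;>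
      · simp only [weight, hcw]
        simp [stepCost, pow_succ']

theorem weight_start_of_link {l : List Letter} (h : toWord l 0 = link true) :
    weight .start l = 0 := by
  rcases l with _ | ⟨x, l⟩
  · simp [toWord] at h
  · rw [toWord_cons_zero] at h
    rw [h, weight]

/-- A forbidden `link true` is met in phase `start`, where the weight vanishes. Sums may therefore
run over all words. -/
theorem weight_eq_zero {l : List Letter} (hl : ¬ Valid (toWord l)) (s : Phase) :
    weight s l = 0 := by
  induction l generalizing s with
  | nil => exact absurd valid_toWord_nil hl
  | cons x l ih =>
    rw [valid_toWord_cons, not_and_or] at hl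
    rcases hl with hl | hl
    · push Not at hl
      obtain ⟨t, b, rfl, h⟩ := hl
      rw [weight, weight_start_of_link h, mul_zero]
    · rcases x with ⟨t, b⟩ | ⟨_ | _⟩ <;> cases s <;> simp [weight, ih hl]

/-! ### Summing over words: the linear system. -/

/-- The words of length `n`. -/
def words : ℕ → Finset (List Letter)
  | 0 => {[]}
  | n + 1 => (Finset.univ ×ˢ words n).image fun y => y.1 :: y.2

theorem mem_words {n : ℕ} {l : List Letter} : l ∈ words n ↔ l.length = n := by
  induction n generalizing l with
  | zero => simp [words]
  | succ n ih => cases l <;> simp [words, ih]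

theorem sum_words_succ {n : ℕ} (f : List Letter → ℤ[X]) :
    ∑ l ∈ words (n + 1), f l = ∑ x : Letter, ∑ l ∈ words n, f (x :: l) := by
  rw [words, Finset.sum_image, Finset.sum_product]
  rintro ⟨x, l⟩ - ⟨y, l'⟩ - h
  simpa using h

theorem sum_letter (f : Letter → ℤ[X]) : ∑ x : Letter, f x =
    f (split false false) + f (split false true) + f (split true false) + f (split true true) +
      f (link false) + f (link true) := by
  have : (Finset.univ : Finset Letter) = {split false false, split false true, split true false,
    split true true, link false, link true} := by decide
  simp [this]
  ring

/-- Valid words of length `n` correspond bijectively to perfect matchings, and reading starts in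
phase `cut` because no `split` precedes the first letter. -/
theorem forcingPolynomial_eq_sum (n : ℕ) :
    forcingPolynomial (polyomino n) = ∑ l ∈ words n, weight .cut l := by
  classical
  rw [← Finset.sum_filter_add_sum_filter_not (words n) fun l => Valid (toWord l),
    Finset.sum_eq_zero (s := {l ∈ words n | ¬ Valid (toWord l)}) fun l hl =>
      weight_eq_zero (Finset.mem_filter.1 hl).2 _, add_zero]
  symm
  refine Finset.sum_bij (fun l _ => wordMatching (toWord l) n) ?_ ?_ ?_ ?_
  · intro l hl
    simp only [Finset.mem_filter, mem_words] at hl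
    simp only [Set.Finite.mem_toFinset, Set.mem_ofPred_eq]
    exact wordMatching_isPerfectMatching hl.2 fun k hk => by simp [toWord_of_le (hl.1.trans_le hk)]
  · intro l hl l' hl' h
    simp only [Finset.mem_filter, mem_words] at hl hl'
    exact toWord_injective (hl.1.trans hl'.1.symm) (wordMatching_injective hl.2 hl'.2
      (fun k hk => toWord_of_le (hl.1.trans_le hk)) (fun k hk => toWord_of_le (hl'.1.trans_le hk)) h)
  · intro M hM
    simp only [Set.Finite.mem_toFinset, Set.mem_ofPred_eq] at hM
    have := toWord_range_map (a := readLetter M) (n := n) fun k hk => readLetter_of_le hk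
    refine ⟨(List.range n).map (readLetter M), ?_, ?_⟩
    · simpa [mem_words, this] using readLetter_valid hM
    · rw [this, wordMatching_readLetter hM]
  · intro l hl
    simp only [Finset.mem_filter, mem_words] at hl
    obtain ⟨hl, hv⟩ := hl
    obtain ⟨⟨c, ⟨st, hst, h0, rfl⟩, hw⟩, -⟩ := weight_eq_pow l hv
    subst hl
    rw [hw, forcingNumber_wordMatching hst h0]

/-- Sorting by the first letter: the four `split`s give the coefficient `4`, the two `link`s the
coefficient `2`. -/
theorem sum_weight_cut_succ (n : ℕ) : ∑ l ∈ words (n + 1), weight .cut l =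
    4 * X ^ 2 * ∑ l ∈ words n, weight .start l + 2 * X * ∑ l ∈ words n, weight .cut l := by
  simp only [sum_words_succ, sum_letter, weight, ← Finset.mul_sum]
  ring

theorem sum_weight_start_succ (n : ℕ) : ∑ l ∈ words (n + 1), weight .start l =
    4 * X ^ 2 * ∑ l ∈ words n, weight .start l + X * ∑ l ∈ words n, weight .free l := by
  simp only [sum_words_succ, sum_letter, weight, ← Finset.mul_sum, Finset.sum_const_zero]
  ring

theorem sum_weight_free_succ (n : ℕ) : ∑ l ∈ words (n + 1), weight .free l =
    4 * X ^ 2 * ∑ l ∈ words n, weight .start l + X * ∑ l ∈ words n, weight .free l +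
      ∑ l ∈ words n, weight .cut l := by
  simp only [sum_words_succ, sum_letter, weight, ← Finset.mul_sum]
  ring

end ForcingPoly

theorem theorem3p1 :
    (∀ n : ℕ, 3 ≤ n →
      ForcingPoly.forcingPolynomial (ForcingPoly.polyomino n) =
        (4 * X ^ 2 + 3 * X) * ForcingPoly.forcingPolynomial (ForcingPoly.polyomino (n - 1))
        - (8 * X ^ 3 + 2 * X ^ 2) * ForcingPoly.forcingPolynomial (ForcingPoly.polyomino (n - 2))
        + 4 * X ^ 3 * ForcingPoly.forcingPolynomial (ForcingPoly.polyomino (n - 3))) ∧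
    ForcingPoly.forcingPolynomial (ForcingPoly.polyomino 0) = 1 ∧
    ForcingPoly.forcingPolynomial (ForcingPoly.polyomino 1) = 4 * X ^ 2 + 2 * X ∧
    ForcingPoly.forcingPolynomial (ForcingPoly.polyomino 2) =
      16 * X ^ 4 + 12 * X ^ 3 + 4 * X ^ 2 := by
  have h0 : ∀ s, ∑ l ∈ ForcingPoly.words 0, ForcingPoly.weight s l = 1 := fun s => by
    simp [ForcingPoly.words, ForcingPoly.weight]
  simp only [ForcingPoly.forcingPolynomial_eq_sum]
  refine ⟨fun n hn => ?_, h0 _, ?_, ?_⟩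
  · obtain ⟨m, rfl⟩ := Nat.exists_eq_add_of_le' hn
    -- Unfolding the system down to length `m` turns the recurrence into an identity that is linear
    -- in the three sums over `words m`.
    simp only [show m + 3 - 1 = m + 1 + 1 by omega, show m + 3 - 2 = m + 1 by omega,
      show m + 3 - 3 = m by omega, show m + 3 = m + 1 + 1 + 1 by omega,
      ForcingPoly.sum_weight_cut_succ, ForcingPoly.sum_weight_start_succ,
      ForcingPoly.sum_weight_free_succ]
    ring
  · rw [ForcingPoly.sum_weight_cut_succ 0, h0, h0]
    ring
  · rw [ForcingPoly.sum_weight_cut_succ 1, ForcingPoly.sum_weight_cut_succ 0,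
      ForcingPoly.sum_weight_start_succ 0, h0, h0, h0]
    ring
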